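/- Let $F$ be a field of characteristic zero and let $E$ be the infinite dimensional (unital) Grassmann algebra over $F$ of a vector space $L$ with basis $e_1,e_2,\ldots$. Let $m<n$ be integers and split the set of generators $e_i$ into two infinite sets; give the generators in the first set degree $m$ and those in the second set degree $n$. Denote by $E_{(m,n)}^{(\infty,\infty)}$ the algebra $E$ with the induced $\mathbb{Z}$-grading, in which $\|e_{k_1}\cdots e_{k_s}\|=\|e_{k_1}\|+\cdots+\|e_{k_s}\|$. Suppose that this grading has full support, that is, every homogeneous component is nonzero, and that there are $\alpha,\beta,\alpha',\beta'\in\{0,1,2,\ldots\}$ with $$1=\alpha m+\beta n,\qquad -1=\alpha' m+\beta' n,$$ such that $\alpha+\beta$ and $\alpha'+\beta'$ are both even (the sums are not required to be minimal among all such representations; if both minimal sums happen to be even, the hypothesis holds). Then $E_{(m,n)}^{(\infty,\infty)}$ generates the variety $\mathfrak{V}_1^{\mathbb{Z}}$ of $\mathbb{Z}$-graded algebras defined by the polynomials $[x_1,x_2,x_3]=[[x_1,x_2],x_3]$ for all degrees of $x_1,x_2,x_3$. That is, the ideal $T_{\mathbb{Z}}(E_{(m,n)}^{(\infty,\infty)})$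 of all $\mathbb{Z}$-graded polynomial identities of $E_{(m,n)}^{(\infty,\infty)}$ in the free $\mathbb{Z}$-graded algebra $F\langle X|\mathbb{Z}\rangle$ (countably many variables in each degree) is equal to the $T_{\mathbb{Z}}$-ideal generated by these polynomials, i.e. the smallest two-sided ideal that contains them and is invariant under all $\mathbb{Z}$-graded endomorphisms of $F\langle X|\mathbb{Z}\rangle$. -/

import Mathlib

open scoped DirectSum

noncomputable section

namespace GradedPI

section Grassmann

variable (F : Type*) [Field F]

/-- The infinite dimensional Grassmann algebra `E` of the vector space `L` with basis indexed
by `ℕ`. -/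
abbrev Grassmann : Type _ := ExteriorAlgebra F (ℕ →₀ F)

/-- The generator `e_i` of the Grassmann algebra. -/
def gen (i : ℕ) : Grassmann F := ExteriorAlgebra.ι F (Finsupp.single i 1)

/-- The monomial `e_{k_1} ⋯ e_{k_s}` (it is zero when a generator is repeated). -/
def monomial (l : List ℕ) : Grassmann F := (l.map (gen F)).prod

/-- The homogeneous component of degree `r` of the `ℤ`-grading on `E` in which the generator
`e_i` has degree `deg i`: the span of all monomials `e_{k_1} ⋯ e_{k_s}` with
`deg k_1 + ⋯ + deg k_s = r`. -/
def inducedGrading (deg : ℕ → ℤ) (r : ℤ) : Submodule F (Grassmann F) :=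
  Submodule.span F {w | ∃ l : List ℕ, (l.map deg).sum = r ∧ w = monomial F l}

variable {F}

lemma gen_mem (deg : ℕ → ℤ) (i : ℕ) : gen F i ∈ inducedGrading F deg (deg i) :=
  Submodule.subset_span ⟨[i], by simp, by simp [monomial]⟩

lemma gen_mul_gen_add_swap (i j : ℕ) : gen F i * gen F j + gen F j * gen F i = 0 :=
  ExteriorAlgebra.ι_add_mul_swap _ _

instance inducedGrading.gradedMonoid (deg : ℕ → ℤ) :
    SetLike.GradedMonoid (inducedGrading F deg) where
  one_mem := Submodule.subset_span ⟨[], by simp, by simp [monomial]⟩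
  mul_mem := by
    intro i j x y hx hy
    have h : inducedGrading F deg i * inducedGrading F deg j ≤ inducedGrading F deg (i + j) := by
      unfold inducedGrading
      rw [Submodule.span_mul_span]
      apply Submodule.span_mono
      rintro _ ⟨_, ⟨l, hl, rfl⟩, _, ⟨l', hl', rfl⟩, rfl⟩
      exact ⟨l ++ l', by simp [hl, hl'], by simp [monomial]⟩
    exact h (Submodule.mul_mem_mul hx hy)

/-- The generator `e_i` inside the direct sum of the homogeneous components. -/
def gradedGen (deg : ℕ → ℤ) (i : ℕ) : ⨁ r, inducedGrading F deg r :=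
  DirectSum.of (fun r => inducedGrading F deg r) (deg i) ⟨gen F i, gen_mem deg i⟩

lemma of_mul_of_eq (deg : ℕ → ℤ) {i j k : ℤ} (h : i + j = k) {x y : Grassmann F}
    (hx : x ∈ inducedGrading F deg i) (hy : y ∈ inducedGrading F deg j)
    (hxy : x * y ∈ inducedGrading F deg k) :
    DirectSum.of (fun r => inducedGrading F deg r) i ⟨x, hx⟩ *
      DirectSum.of (fun r => inducedGrading F deg r) j ⟨y, hy⟩ =
      DirectSum.of (fun r => inducedGrading F deg r) k ⟨x * y, hxy⟩ := by
  subst h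
  exact DirectSum.of_mul_of _ _

lemma gradedGen_add_swap (deg : ℕ → ℤ) (i j : ℕ) :
    gradedGen (F := F) deg i * gradedGen deg j + gradedGen deg j * gradedGen deg i = 0 := by
  have hm : gen F i * gen F j ∈ inducedGrading F deg (deg i + deg j) :=
    SetLike.mul_mem_graded (gen_mem deg i) (gen_mem deg j)
  have hm' : gen F j * gen F i ∈ inducedGrading F deg (deg i + deg j) := by
    rw [add_comm]
    exact SetLike.mul_mem_graded (gen_mem deg j) (gen_mem deg i)
  unfold gradedGen
  rw [of_mul_of_eq deg rfl _ _ hm, of_mul_of_eq deg (add_comm _ _) _ _ hm', ← map_add]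
  have h0 : (⟨gen F i * gen F j, hm⟩ : inducedGrading F deg (deg i + deg j)) +
      ⟨gen F j * gen F i, hm'⟩ = 0 := Subtype.ext (gen_mul_gen_add_swap i j)
  rw [h0, map_zero]

lemma gradedGen_sq (deg : ℕ → ℤ) (i : ℕ) :
    gradedGen (F := F) deg i * gradedGen deg i = 0 := by
  have hm : gen F i * gen F i ∈ inducedGrading F deg (deg i + deg i) :=
    SetLike.mul_mem_graded (gen_mem deg i) (gen_mem deg i)
  unfold gradedGen
  rw [of_mul_of_eq deg rfl _ _ hm]
  have h0 : (⟨gen F i * gen F i, hm⟩ : inducedGrading F deg (deg i + deg i)) = 0 :=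
    Subtype.ext (ExteriorAlgebra.ι_sq_zero _)
  rw [h0, map_zero]

/-- The inclusion of `L` into the direct sum of the homogeneous components. -/
def gradedι (deg : ℕ → ℤ) : (ℕ →₀ F) →ₗ[F] ⨁ r, inducedGrading F deg r :=
  Finsupp.linearCombination F (gradedGen deg)

lemma gradedι_add_swap (deg : ℕ → ℤ) (x y : ℕ →₀ F) :
    gradedι deg x * gradedι deg y + gradedι deg y * gradedι deg x = 0 := by
  induction x using Finsupp.induction_linear with
  | zero => simp
  | add a b ha hb =>
    rw [map_add, add_mul, mul_add, add_add_add_comm, ha, hb, add_zero]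
  | single i a =>
    induction y using Finsupp.induction_linear with
    | zero => simp
    | add b c hb hc =>
      rw [map_add, add_mul, mul_add, add_add_add_comm, hb, hc, add_zero]
    | single j b =>
      simp only [gradedι, Finsupp.linearCombination_single, smul_mul_smul_comm]
      rw [mul_comm b a, ← smul_add, gradedGen_add_swap, smul_zero]

lemma gradedι_sq (deg : ℕ → ℤ) (x : ℕ →₀ F) : gradedι deg x * gradedι deg x = 0 := by
  induction x using Finsupp.induction_linear with
  | zero => simp
  | add a b ha hb =>
    rw [map_add, add_mul, mul_add, mul_add, ha, hb, zero_add, add_zero, gradedι_add_swap]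
  | single i a =>
    simp only [gradedι, Finsupp.linearCombination_single, smul_mul_smul_comm, gradedGen_sq,
      smul_zero]

/-- The decomposition of an element of `E` into its homogeneous components. -/
def gradedLift (deg : ℕ → ℤ) : Grassmann F →ₐ[F] ⨁ r, inducedGrading F deg r :=
  ExteriorAlgebra.lift F ⟨gradedι deg, gradedι_sq deg⟩

lemma gradedLift_gen (deg : ℕ → ℤ) (i : ℕ) :
    gradedLift deg (gen F i) = gradedGen deg i := by
  simp [gradedLift, gen, gradedι]

lemma gradedLift_monomial (deg : ℕ → ℤ) (l : List ℕ) (r : ℤ) (hr : (l.map deg).sum = r)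
    (hm : monomial F l ∈ inducedGrading F deg r) :
    gradedLift deg (monomial F l) =
      DirectSum.of (fun r => inducedGrading F deg r) r ⟨monomial F l, hm⟩ := by
  induction l generalizing r with
  | nil =>
    subst hr
    simp only [monomial, List.map_nil, List.prod_nil, map_one, DirectSum.one_def]
    rfl
  | cons i l ih =>
    have h1 : monomial F l ∈ inducedGrading F deg (l.map deg).sum :=
      Submodule.subset_span ⟨l, rfl, rfl⟩
    have h2 : monomial F (i :: l) = gen F i * monomial F l := by simp [monomial]
    have h3 : gen F i * monomial F l ∈ inducedGrading F deg r := h2 ▸ hm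
    simp only [h2]
    rw [map_mul, gradedLift_gen, ih _ rfl h1, gradedGen]
    exact of_mul_of_eq deg (by simpa using hr) _ _ h3

/-- The induced components do form a `ℤ`-grading of the algebra `E`. -/
instance inducedGrading.gradedAlgebra (deg : ℕ → ℤ) : GradedAlgebra (inducedGrading F deg) :=
  GradedAlgebra.ofAlgHom _ (gradedLift deg)
    (by
      ext i
      simp [gradedLift, gradedι, gradedGen, gen])
    (by
      rintro r ⟨x, hx⟩
      dsimp only
      induction hx using Submodule.span_induction with
      | mem x h =>
        obtain ⟨l, hl, rfl⟩ := h
        exact gradedLift_monomial deg l r hl _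
      | zero =>
        rw [map_zero]
        exact (map_zero (DirectSum.of (fun r => inducedGrading F deg r) r)).symm
      | add x y hx hy ihx ihy =>
        rw [map_add, ihx, ihy, ← map_add]
        rfl
      | smul a x hx ih =>
        rw [map_smul, ih, ← DirectSum.lof_eq_of F, ← map_smul, DirectSum.lof_eq_of]
        rfl)

open scoped Classical in
/-- The degree of the generator `e_i` for the splitting of the generators into the set of those
with `i ∈ S`, which get degree `m`, and the set of the others, which get degree `n`. -/
def twoDegree (m n : ℤ) (S : Set ℕ) (i : ℕ) : ℤ := if i ∈ S then m else n

variable (F)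

/-- The `2`-induced grading `E_{(m, n)}^{(u, v)}` for the decomposition `L = L_m^u ⊕ L_n^v`, where
`L_m^u` is spanned by the `e_i` with `i ∈ S`, and `L_n^v` by the other `e_i`. The
upper indexes `u` and `v` are the numbers of elements of `S` and of its complement. -/
abbrev twoInduced (m n : ℤ) (S : Set ℕ) : ℤ → Submodule F (Grassmann F) :=
  inducedGrading F (twoDegree m n S)

end Grassmann

section Identities

variable {F : Type*} [Field F]

/-- The support of a `ℤ`-grading: the set of degrees whose component is nonzero. -/
def gradingSupport {A : Type*} [Ring A] [Algebra F A] (𝒜 : ℤ → Submodule F A) : Set ℤ :=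
  {r | 𝒜 r ≠ ⊥}

variable (F) in
/-- The free algebra `F⟨X|ℤ⟩`; the pair `(i, k)` stands for the variable `x_k^i`, of degree `i`. -/
abbrev FreeGraded : Type _ := FreeAlgebra F (ℤ × ℕ)

variable (F) in
/-- The variable `x_k^i`. -/
def var (i : ℤ) (k : ℕ) : FreeGraded F := FreeAlgebra.ι F (i, k)

variable (F) in
/-- The component `F⟨X|ℤ⟩^i`: the span of all monomials in the variables of degree `i`. -/
def freeComponent (i : ℤ) : Submodule F (FreeGraded F) :=
  Submodule.span F {w | ∃ l : List (ℤ × ℕ),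
    (l.map Prod.fst).sum = i ∧ w = (l.map (fun p => var F p.1 p.2)).prod}

/-- `T_ℤ(A)`: the ideal of all `ℤ`-graded polynomial identities of the graded algebra `A`, the
polynomials that vanish under every substitution of elements of `A_i` for the variables of
degree `i`, for all `i`. -/
def gradedIdentities {A : Type*} [Ring A] [Algebra F A] (𝒜 : ℤ → Submodule F A)
    [GradedAlgebra 𝒜] : TwoSidedIdeal (FreeGraded F) :=
  TwoSidedIdeal.mk'
    {f | ∀ g : ℤ × ℕ → A, (∀ p, g p ∈ 𝒜 p.1) → FreeAlgebra.lift F g f = 0}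
    (fun _ _ => map_zero _)
    (fun hx hy g hg => by rw [map_add, hx g hg, hy g hg, add_zero])
    (fun hx g hg => by rw [map_neg, hx g hg, neg_zero])
    (fun hy g hg => by rw [map_mul, hy g hg, mul_zero])
    (fun hx g hg => by rw [map_mul, hx g hg, zero_mul])

/-- A `T_ℤ`-ideal: a two-sided ideal of `F⟨X|ℤ⟩` that every `ℤ`-graded endomorphism maps into
itself. -/
def IsTIdeal (I : TwoSidedIdeal (FreeGraded F)) : Prop :=
  ∀ φ : FreeGraded F →ₐ[F] FreeGraded F,
    (∀ i, ∀ f ∈ freeComponent F i, φ f ∈ freeComponent F i) → ∀ f ∈ I, φ f ∈ I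

/-- The `T_ℤ`-ideal generated by a set of graded polynomials. -/
def tIdealSpan (P : Set (FreeGraded F)) : TwoSidedIdeal (FreeGraded F) :=
  sInf {I | IsTIdeal I ∧ ∀ f ∈ P, f ∈ I}

/-- The graded algebra `A` generates the variety of the `ℤ`-graded algebras that satisfy the
identities `P`: the `T_ℤ`-ideal of the variety, which is the one generated by `P`, is `T_ℤ(A)`. -/
def GeneratesVariety {A : Type*} [Ring A] [Algebra F A] (𝒜 : ℤ → Submodule F A)
    [GradedAlgebra 𝒜] (P : Set (FreeGraded F)) : Prop :=
  tIdealSpan P = gradedIdentities 𝒜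

/-- The commutator `[a, b] = ab - ba`. -/
def comm {A : Type*} [Ring A] (a b : A) : A := a * b - b * a

variable (F) in
/-- The polynomials `[x_1, x_2, x_3] = [[x_1, x_2], x_3]` for all degrees of the three variables;
they define the variety `𝔙_1`. -/
def tripleCommutators : Set (FreeGraded F) :=
  {f | ∃ i j k : ℤ, f = comm (comm (var F i 1) (var F j 2)) (var F k 3)}

end Identities

end GradedPI

end

/-! Commutators in `E` are central, which gives one inclusion. For the other, work modulo the ideal
generated by the triple commutators. Centrality of commutators and division by 2 make products of
commutators alternate in all their entries. Every polynomial therefore reduces to a combination of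
normal forms: a multiset of variables multiplied in a fixed order, times commutators of distinct
variables, even in number (`exists_normalForm_sub_mem`).

It remains to see that no nontrivial combination of these is a graded identity of `E`
(`sum_normalForm_eq_zero`). The parity hypothesis yields nonempty words of even length in every
degree; one more letter of degree `m` yields words of odd length. Both sets of generators are
infinite, so the words can be taken disjoint. Each degree thus contains many central square-zero
elements and anticommuting ones, all with nonzero products.

For a normal form `(a, T)`, substitute for each variable `p` a sum of `a.count p` such central
elements, plus an odd one if `p ∈ T` (`probe`). There `(a, T)` is nonzero, while another `(b, U)`
can survive only if `U ⊂ T`, or `U = T` and `b < a`. This triangularity kills the coefficients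
(`coeff_eq_zero_of_probe`). -/

noncomputable section

namespace GradedPI

/-! ### Normal forms in algebras with central commutators. -/

section CentralCommutators

variable {F : Type*} [Field F] {ι : Type*} {A : Type*} [Ring A] [Algebra F A]

/-- The product `[x_{i_1}, x_{i_2}][x_{i_3}, x_{i_4}] ⋯` along a list of even length; it is zero
for lists of odd length. -/
def commProd (x : ι → A) : List ι → A
  | [] => 1
  | [_] => 0
  | a :: b :: l => comm (x a) (x b) * commProd x l

/-- The product of the variables in `q.1` times the product of commutators of the variables
in `q.2`. -/
def normalForm (x : ι → A) (q : Multiset ι × Finset ι) : A :=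
  (q.1.toList.map x).prod * commProd x q.2.toList

lemma map_comm {B : Type*} [Ring B] [Algebra F B] (φ : A →ₐ[F] B) (a b : A) :
    φ (comm a b) = comm (φ a) (φ b) := by simp [comm]

lemma map_commProd {B : Type*} [Ring B] [Algebra F B] (φ : A →ₐ[F] B) (x : ι → A) :
    ∀ l : List ι, φ (commProd x l) = commProd (fun i => φ (x i)) l
  | [] => by simp [commProd]
  | [_] => by simp [commProd]
  | a :: b :: l => by simp [commProd, map_comm, map_commProd φ x l]

lemma map_normalForm {B : Type*} [Ring B] [Algebra F B] (φ : A →ₐ[F] B) (x : ι → A)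
    (q : Multiset ι × Finset ι) :
    φ (normalForm x q) = normalForm (fun i => φ (x i)) q := by
  simp [normalForm, map_commProd, map_list_prod, Function.comp_def]

lemma commProd_of_odd (x : ι → A) : ∀ l : List ι, Odd l.length → commProd x l = 0
  | [], h => by simp at h
  | [_], _ => rfl
  | a :: b :: l, h => by
    have : Odd l.length := by
      simp only [List.length_cons] at h
      grind
    rw [commProd, commProd_of_odd x l this, mul_zero]

/-- Commutators are central. -/
def CentralComm (A : Type*) [Ring A] : Prop := ∀ a b c : A, comm (comm a b) c = 0

lemma CentralComm.commute (h : CentralComm A) (a b c : A) : comm a b * c = c * comm a b :=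
  sub_eq_zero.1 (h a b c)

lemma commProd_commute (h : CentralComm A) (x : ι → A) (c : A) :
    ∀ l : List ι, commProd x l * c = c * commProd x l
  | [] => by simp [commProd]
  | [_] => by simp [commProd]
  | a :: b :: l => by
    rw [commProd, mul_assoc, commProd_commute h x c l, ← mul_assoc, h.commute, mul_assoc]

variable [CharZero F]

-- By centrality `[a², b] = 2a[a, b]`; taking the commutator with `c` gives `2[a, b][a, c]`, which
-- is zero because `[a², b]` is central as well.
include F in
lemma CentralComm.mul_self (h : CentralComm A) (a b c : A) : comm a b * comm a c = 0 := by
  have h1 : comm (a * a) b = 2 * (a * comm a b) := by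
    have := h.commute a b a
    have e : comm (a * a) b = a * comm a b + comm a b * a := by simp only [comm]; noncomm_ring
    rw [e, this, two_mul]
  have h2 : comm (2 * (a * comm a b)) c = 2 * (comm a b * comm a c) := by
    have := h.commute a b c
    have e : comm (2 * (a * comm a b)) c = 2 * (a * (comm a b * c) - c * a * comm a b) := by
      simp only [comm]; noncomm_ring
    rw [e, this, h.commute a b (comm a c)]
    simp only [comm]; noncomm_ring
  rw [← h1, h] at h2
  have h3 : (2 : F) • (comm a b * comm a c) = 0 := by
    rw [ofNat_smul_eq_nsmul, two_nsmul, ← two_mul, ← h2]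
  exact (smul_eq_zero.1 h3).resolve_left two_ne_zero

-- Polarization of `CentralComm.mul_self` in the repeated entry.
include F in
lemma CentralComm.swap (h : CentralComm A) (z a b w : A) :
    comm z a * comm b w = -(comm z b * comm a w) := by
  have h1 := h.mul_self (F := F) (a + b) z w
  have h2 := h.mul_self (F := F) a z w
  have h3 := h.mul_self (F := F) b z w
  have e : comm z a * comm b w + comm z b * comm a w =
    comm a z * comm a w + comm b z * comm b w - comm (a + b) z * comm (a + b) w := by
    simp only [comm]; noncomm_ring
  rw [h1, h2, h3] at e
  exact eq_neg_of_add_eq_zero_left (by simpa using e)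

-- Two neighbours lie either in one commutator, where antisymmetry applies, or across the border of
-- two commutators, where `CentralComm.swap` does.
include F in
lemma commProd_swap (h : CentralComm A) (x : ι → A) (a b : ι) (l' : List ι) :
    ∀ l : List ι, commProd x (l ++ a :: b :: l') = -commProd x (l ++ b :: a :: l')
  | [] => by
    simp only [List.nil_append, commProd, comm]; noncomm_ring
  | [z] => by
    rcases l' with _ | ⟨w, l'⟩
    · simp [commProd]
    · simp only [List.cons_append, List.nil_append, commProd]
      rw [← mul_assoc, h.swap (F := F), ← mul_assoc, neg_mul]
  | z :: w :: l => by
    simp only [List.cons_append, commProd]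
    rw [commProd_swap h x a b l' l, mul_neg]

include F in
lemma commProd_perm (h : CentralComm A) (x : ι → A) {l l' : List ι} (hl : l.Perm l')
    (k : List ι) :
    commProd x (k ++ l) = commProd x (k ++ l') ∨ commProd x (k ++ l) = -commProd x (k ++ l') := by
  induction hl generalizing k with
  | nil => exact Or.inl rfl
  -- The prefix `k` is what lets the induction run: `commProd` pairs its entries, so a single head
  -- cannot be split off, but it can be moved into the prefix.
  | cons a _ ih => simpa using ih (k ++ [a])
  | swap a b l => exact Or.inr (commProd_swap (F := F) h x _ _ _ _)
  | trans _ _ ih1 ih2 =>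
    rcases ih1 k with e1 | e1 <;> rcases ih2 k with e2 | e2 <;> simp [e1, e2]

include F in
lemma commProd_of_not_nodup (h : CentralComm A) (x : ι → A) {l : List ι} (hl : ¬ l.Nodup) :
    commProd x l = 0 := by
  obtain ⟨a, ha⟩ : ∃ a, List.Sublist [a, a] l := by
    simpa [List.nodup_iff_sublist] using hl
  obtain ⟨k, hk⟩ := ha.exists_perm_append
  have h0 : commProd x (a :: a :: k) = 0 := by simp [commProd, comm]
  rcases commProd_perm (F := F) h x hk [] with e | e <;> simpa [h0] using e

open scoped Classical in
include F in
lemma commProd_eq_toFinset (h : CentralComm A) (x : ι → A) (l : List ι) :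
    ∃ S : Finset ι, ∃ c : F, commProd x l = c • commProd x S.toList := by
  by_cases hl : l.Nodup
  · have hp : l.Perm l.toFinset.toList := ((List.toFinset_toList hl)).symm
    refine ⟨l.toFinset, ?_⟩
    rcases commProd_perm (F := F) h x hp [] with e | e
    · exact ⟨1, by simpa using e⟩
    · exact ⟨-1, by simpa using e⟩
  · exact ⟨∅, 0, by rw [commProd_of_not_nodup (F := F) h x hl, zero_smul]⟩

variable (F) in
/-- The span of the normal forms. -/
def normalSpan (x : ι → A) : Submodule F A := Submodule.span F (Set.range (normalForm x))

lemma toList_mul_commProd_mem (h : CentralComm A) (x : ι → A) (a : Multiset ι) (k : List ι) :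
    (a.toList.map x).prod * commProd x k ∈ normalSpan F x := by
  obtain ⟨S, c, e⟩ := commProd_eq_toFinset (F := F) h x k
  rw [e, mul_smul_comm]
  exact Submodule.smul_mem _ _ (Submodule.subset_span ⟨(a, S), rfl⟩)

omit [CharZero F] in
lemma prod_mul_commProd_sub_mem (h : CentralComm A) (x : ι → A) (n : ℕ)
    (hn : ∀ l : List ι, l.length < n → ∀ k, (l.map x).prod * commProd x k ∈ normalSpan F x)
    {l l' : List ι} (hl : l.Perm l') (j k : List ι) (hj : (j ++ l).length ≤ n) :
    ((j ++ l).map x).prod * commProd x k - ((j ++ l').map x).prod * commProd x k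
      ∈ normalSpan F x := by
  induction hl generalizing j with
  | nil => simp
  | cons a _ ih => simpa using ih (j ++ [a]) (by simpa [add_assoc] using hj)
  | swap a b l =>
    -- Exchanging two neighbours costs a commutator, which is central and moves right into the
    -- commutator factor; the remaining product is shorter by two.
    have := hn (j ++ l) (by simp at hj ⊢; omega) (b :: a :: k)
    convert this using 1
    simp only [List.map_append, List.map_cons, List.prod_append, List.prod_cons, commProd]
    have e := h.commute (x b) (x a) (l.map x).prod
    have e2 : (j.map x).prod * (l.map x).prod * (comm (x b) (x a) * commProd x k) =
        (j.map x).prod * (comm (x b) (x a) * (l.map x).prod) * commProd x k := by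
      rw [e]; simp only [mul_assoc]
    rw [e2]
    simp only [comm]; noncomm_ring
  | trans h1 h2 ih1 ih2 =>
    have := (normalSpan F x).add_mem (ih1 j hj)
      (ih2 j (by simpa [h1.length_eq] using hj))
    simpa using this

/-- Straightening by induction on length: reorder the product into the chosen order of its multiset,
with correction terms of smaller length. -/
lemma prod_mul_commProd_mem (h : CentralComm A) (x : ι → A) (n : ℕ) :
    ∀ l : List ι, l.length < n → ∀ k, (l.map x).prod * commProd x k ∈ normalSpan F x := by
  induction n with
  | zero => intro l hl; simp at hl
  | succ n ih =>
    intro l hl k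
    have hp : l.Perm (l : Multiset ι).toList := Multiset.coe_eq_coe.1 (by simp)
    have h1 := prod_mul_commProd_sub_mem h x n ih hp [] k (by simp; omega)
    have h2 := toList_mul_commProd_mem (F := F) h x l k
    simpa using (normalSpan F x).add_mem h1 h2

omit [CharZero F] in
/-- The subalgebra generated by the `x i` is spanned by their products. -/
lemma lift_mem_span_prod (x : ι → A) (f : FreeAlgebra F ι) :
    FreeAlgebra.lift F x f ∈
      Submodule.span F (Set.range fun l : List ι => (l.map x).prod) := by
  have hmul : ∀ a b, a ∈ Submodule.span F (Set.range fun l : List ι => (l.map x).prod) →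
      b ∈ Submodule.span F (Set.range fun l : List ι => (l.map x).prod) →
      a * b ∈ Submodule.span F (Set.range fun l : List ι => (l.map x).prod) := by
    intro a b ha hb
    have := Submodule.mul_mem_mul ha hb
    rw [Submodule.span_mul_span] at this
    refine Submodule.span_mono ?_ this
    rintro _ ⟨_, ⟨l, rfl⟩, _, ⟨l', rfl⟩, rfl⟩
    exact ⟨l ++ l', by simp⟩
  induction f using FreeAlgebra.induction with
  | grade0 r =>
    rw [AlgHom.commutes, Algebra.algebraMap_eq_smul_one]
    exact Submodule.smul_mem _ _ (Submodule.subset_span ⟨[], by simp⟩)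
  | grade1 i => exact Submodule.subset_span ⟨[i], by simp⟩
  | mul a b ha hb => rw [map_mul]; exact hmul _ _ ha hb
  | add a b ha hb => rw [map_add]; exact Submodule.add_mem _ ha hb

/-- An algebra with central commutators is spanned by the normal forms in its generators. -/
lemma lift_mem_normalSpan (h : CentralComm A) (x : ι → A) (f : FreeAlgebra F ι) :
    FreeAlgebra.lift F x f ∈ normalSpan F x := by
  refine Submodule.span_le.2 ?_ (lift_mem_span_prod x f)
  rintro _ ⟨l, rfl⟩
  simpa [commProd] using prod_mul_commProd_mem (F := F) h x (l.length + 1) l (by simp) []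

end CentralCommutators

/-! ### Values of normal forms at sums of central and anticommuting elements. -/

section Evaluation

variable {ι : Type*} {A : Type*} [Ring A]

lemma commProd_eq_zero_of_commute (g : ι → A) {p : ι} (hp : ∀ z, Commute (g p) z) :
    ∀ l : List ι, p ∈ l → commProd g l = 0
  | [], h => by simp at h
  | [_], _ => rfl
  | a :: b :: l, h => by
    rw [commProd]
    rcases List.mem_cons.1 h with rfl | h
    · simp [comm, (hp (g b)).eq]
    rcases List.mem_cons.1 h with rfl | h
    · simp [comm, (hp (g a)).eq]
    · rw [commProd_eq_zero_of_commute g hp l h, mul_zero]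

/-- Central parts drop out of a commutator, and `[v a, v b] = 2 v a v b` by anticommutation. -/
lemma commProd_add_eq (u v : ι → A) (hu : ∀ p z, Commute (u p) z)
    (hv : ∀ p q, v p * v q = -(v q * v p)) :
    ∀ l : List ι, Even l.length →
      commProd (fun p => u p + v p) l = 2 ^ (l.length / 2) * (l.map v).prod
  | [], _ => by simp [commProd]
  | [_], h => by simp at h
  | a :: b :: l, h => by
    have hl : Even l.length := by
      simp only [List.length_cons] at h
      grind
    have e : comm (u a + v a) (u b + v b) = 2 * (v a * v b) := by
      have h1 := (hu a (u b)).eq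
      have h2 := (hu a (v b)).eq
      have h3 := (hu b (v a)).eq
      have h4 := hv b a
      simp only [comm, mul_add, add_mul, h1, h2, h3, h4]
      noncomm_ring
    have e2 : (a :: b :: l).length / 2 = l.length / 2 + 1 := by
      simp only [List.length_cons]; omega
    have e3 : (v a * v b) * (2 : A) ^ (l.length / 2) = 2 ^ (l.length / 2) * (v a * v b) :=
      ((Commute.ofNat_right _ 2).pow_right _).eq
    rw [commProd, commProd_add_eq u v hu hv l hl, e, e2, pow_succ', List.map_cons, List.map_cons,
      List.prod_cons, List.prod_cons, mul_assoc 2, ← mul_assoc (v a * v b), e3]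
    simp only [mul_assoc]

lemma mul_prod_eq_zero_of_mem (v : ι → A) (hv : ∀ p q, v p * v q = -(v q * v p))
    (hv2 : ∀ p, v p * v p = 0) (p : ι) (l : List ι) (hp : p ∈ l) :
    v p * (l.map v).prod = 0 := by
  induction l with
  | nil => simp at hp
  | cons a l ih =>
    rw [List.map_cons, List.prod_cons, ← mul_assoc]
    rcases List.mem_cons.1 hp with rfl | h
    · rw [hv2, zero_mul]
    · rw [hv, neg_mul, mul_assoc, ih h, mul_zero, neg_zero]

lemma prod_add_mul_eq (u v : ι → A) (hu : ∀ p z, Commute (u p) z) (z : A)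
    (hz : ∀ p, v p * z = 0) (l : List ι) :
    (l.map fun p => u p + v p).prod * z = (l.map u).prod * z := by
  induction l with
  | nil => simp
  | cons a l ih =>
    have h : v a * (l.map u).prod = (l.map u).prod * v a :=
      (Commute.list_prod_right _ _ (by
        intro x hx
        obtain ⟨p, -, rfl⟩ := List.mem_map.1 hx
        exact (hu p _).symm)).eq
    rw [List.map_cons, List.prod_cons, mul_assoc, ih, add_mul, ← mul_assoc (v a), h, mul_assoc _ (v a),
      hz, mul_zero, add_zero, List.map_cons, List.prod_cons, mul_assoc]

lemma sum_pow_of_sq_eq_zero {C : Type*} [CommRing C] (w : ℕ → C) (hw : ∀ j, w j * w j = 0)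
    (n : ℕ) : (∑ j ∈ Finset.range n, w j) ^ n = n.factorial * ∏ j ∈ Finset.range n, w j ∧
      (∑ j ∈ Finset.range n, w j) ^ (n + 1) = 0 := by
  induction n with
  | zero => simp
  | succ n ih =>
    -- The binomial formula stops after the linear term because `x² = 0`.
    have key (s x : C) (hx : x * x = 0) (k : ℕ) :
        (s + x) ^ (k + 1) = s ^ (k + 1) + (k + 1) * s ^ k * x := by
      induction k with
      | zero => simp
      | succ k ih => rw [pow_succ, ih]; push_cast; linear_combination (k + 1) * s ^ k * hx
    constructor
    · rw [Finset.sum_range_succ, key _ _ (hw n), ih.2, ih.1, Finset.prod_range_succ,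
        Nat.factorial_succ]
      push_cast; ring
    · rw [Finset.sum_range_succ, key _ _ (hw n), pow_succ, ih.2]
      ring

variable [DecidableEq ι]

/-- Some `p` occurs in `b` more often than its sum has square-zero summands, so that power vanishes.
-/
lemma multiset_prod_eq_zero {C : Type*} [CommRing C] (w : ι → ℕ → C)
    (hw : ∀ p j, w p j * w p j = 0) (a b : Multiset ι) (hab : ¬ b ≤ a) :
    (b.map fun p => ∑ j ∈ Finset.range (a.count p), w p j).prod = 0 := by
  rw [Multiset.le_iff_count] at hab
  push Not at hab
  obtain ⟨p, hp⟩ := hab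
  rw [Finset.prod_multiset_map_count]
  refine Finset.prod_eq_zero (i := p)
    (Multiset.mem_toFinset.2 (Multiset.count_pos.1 (by omega))) ?_
  exact pow_eq_zero_of_le hp (sum_pow_of_sq_eq_zero (w p) (hw p) _).2

lemma multiset_prod_self {C : Type*} [CommRing C] (w : ι → ℕ → C)
    (hw : ∀ p j, w p j * w p j = 0) (a : Multiset ι) :
    (a.map fun p => ∑ j ∈ Finset.range (a.count p), w p j).prod =
      (∏ p ∈ a.toFinset, (a.count p).factorial : ℕ) *
        ∏ q ∈ a.toFinset.sigma (fun p => Finset.range (a.count p)), w q.1 q.2 := by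
  rw [Finset.prod_multiset_map_count, Finset.prod_sigma, Nat.cast_prod,
    ← Finset.prod_mul_distrib]
  exact Finset.prod_congr rfl fun p _ => (sum_pow_of_sq_eq_zero (w p) (hw p) _).1

/-- The substitution that picks out the normal form `q`: the even part of the value of `x_p` is a
sum of as many summands as `x_p` occurs in `q.1`, and the odd part is nonzero only for the
variables in `q.2`. -/
def probe (w : ι → ℕ → Subring.center A) (v : ι → A) (q : Multiset ι × Finset ι) (p : ι) : A :=
  ((∑ j ∈ Finset.range (q.1.count p), w p j : Subring.center A) : A) +
    if p ∈ q.2 then v p else 0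

variable (w : ι → ℕ → Subring.center A) (v : ι → A) (hw : ∀ p j, w p j * w p j = 0)
  (hv : ∀ p q, v p * v q = -(v q * v p)) (hv2 : ∀ p, v p * v p = 0)

lemma center_commute (c : Subring.center A) (z : A) : Commute (c : A) z :=
  (Subring.mem_center_iff.1 c.2 z).symm

lemma normalForm_probe_of_not_subset (q r : Multiset ι × Finset ι) (h : ¬ r.2 ⊆ q.2) :
    normalForm (probe w v q) r = 0 := by
  obtain ⟨p, hp, hpq⟩ := Finset.not_subset.1 h
  rw [normalForm, commProd_eq_zero_of_commute _ (p := p) _ _ (by simpa using hp), mul_zero]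
  intro z
  simp only [probe, hpq, if_false, add_zero]
  exact center_commute _ z

-- The commutator factor is a multiple of the product of all `v p` with `p ∈ q.2`. Every odd part
-- annihilates it, so only the central parts of the left factor survive.
include hv hv2 in
lemma normalForm_probe_of_eq (q : Multiset ι × Finset ι) (hq : Even q.2.card) (b : Multiset ι) :
    normalForm (probe w v q) (b, q.2) =
      ((b.map fun p => ∑ j ∈ Finset.range (q.1.count p), w p j).prod : Subring.center A) *
        (2 ^ (q.2.card / 2) * (q.2.toList.map v).prod) := by
  set u : ι → Subring.center A := fun p => ∑ j ∈ Finset.range (q.1.count p), w p j with hu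
  set v' : ι → A := fun p => if p ∈ q.2 then v p else 0 with hv'
  have hg : probe w v q = fun p => (u p : A) + v' p := rfl
  have h1 : ∀ p z, Commute (u p : A) z := fun p z => center_commute _ z
  have h2 : ∀ p q, v' p * v' q = -(v' q * v' p) := by
    intro p q
    simp only [hv']
    split_ifs <;> simp [hv p q]
  have h3 : q.2.toList.map v' = q.2.toList.map v :=
    List.map_congr_left fun p hp => by simp [hv', Finset.mem_toList.1 hp]
  have h4 : ∀ p, v' p * (2 ^ (q.2.card / 2) * (q.2.toList.map v).prod) = 0 := by
    intro p
    by_cases hp : p ∈ q.2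
    · have e := ((Commute.ofNat_right (v p) 2).pow_right (q.2.card / 2)).eq
      simp only [hv', hp, if_true]
      rw [← mul_assoc, e, mul_assoc,
        mul_prod_eq_zero_of_mem v hv hv2 p _ (Finset.mem_toList.2 hp), mul_zero]
    · simp [hv', hp]
  have h5 : ((b.map u).prod : A) = (b.toList.map fun p => (u p : A)).prod := by
    rw [← Multiset.prod_map_toList, SubmonoidClass.coe_list_prod, List.map_map]
    rfl
  rw [normalForm, hg, commProd_add_eq _ v' h1 h2 _ (by simpa using hq), h3, Finset.length_toList,
    prod_add_mul_eq _ v' h1 _ h4, h5]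

include hw hv hv2 in
lemma normalForm_probe_of_not_le (q : Multiset ι × Finset ι) (hq : Even q.2.card)
    (b : Multiset ι) (hb : ¬ b ≤ q.1) : normalForm (probe w v q) (b, q.2) = 0 := by
  rw [normalForm_probe_of_eq w v hv hv2 q hq, multiset_prod_eq_zero w hw _ _ hb]
  simp

include hw hv hv2 in
lemma normalForm_probe_self (q : Multiset ι × Finset ι) (hq : Even q.2.card) :
    normalForm (probe w v q) q =
      ((2 ^ (q.2.card / 2) * ∏ p ∈ q.1.toFinset, (q.1.count p).factorial : ℕ) : A) *
        (((q.1.toFinset.sigma fun p => Finset.range (q.1.count p)).toList.map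
          fun x => (w x.1 x.2 : A)).prod * (q.2.toList.map v).prod) := by
  have h := normalForm_probe_of_eq w v hv hv2 q hq q.1
  rw [multiset_prod_self w hw] at h
  have h5 : ((∏ x ∈ q.1.toFinset.sigma fun p => Finset.range (q.1.count p), w x.1 x.2 :
      Subring.center A) : A) = ((q.1.toFinset.sigma fun p => Finset.range (q.1.count p)).toList.map
          fun x => (w x.1 x.2 : A)).prod := by
    rw [← Finset.prod_map_toList, SubmonoidClass.coe_list_prod, List.map_map]
    rfl
  rw [h, ← h5]
  generalize (∏ x ∈ q.1.toFinset.sigma fun p => Finset.range (q.1.count p), w x.1 x.2) = c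
  generalize (∏ p ∈ q.1.toFinset, (q.1.count p).factorial) = n
  rw [Subring.coe_mul, Subring.coe_natCast, Nat.cast_mul, Nat.cast_pow, Nat.cast_ofNat]
  have e := ((center_commute c (2 : A)).pow_right (q.2.card / 2)).eq
  have e' := (Nat.cast_commute n ((2 : A) ^ (q.2.card / 2))).eq
  rw [mul_assoc, ← mul_assoc (c : A), e, ← mul_assoc, ← mul_assoc, e', mul_assoc, mul_assoc]

end Evaluation

/-! ### Parity, center and nonvanishing of monomials in the Grassmann algebra. -/

section Monomials

variable {F : Type*} [Field F]

lemma monomial_append (l l' : List ℕ) : monomial F (l ++ l') = monomial F l * monomial F l' := by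
  simp [monomial]

lemma monomial_flatMap {K : Type*} (W : K → List ℕ) (ks : List K) :
    monomial F (ks.flatMap W) = (ks.map fun k => monomial F (W k)).prod := by
  induction ks with
  | nil => simp [monomial]
  | cons k ks ih => rw [List.flatMap_cons, monomial_append, ih, List.map_cons, List.prod_cons]

lemma gen_mul_swap (i j : ℕ) : gen F i * gen F j = -(gen F j * gen F i) :=
  eq_neg_of_add_eq_zero_left (gen_mul_gen_add_swap i j)

lemma gen_mul_monomial (i : ℕ) (l : List ℕ) :
    gen F i * monomial F l = (-1) ^ l.length * (monomial F l * gen F i) := by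
  induction l with
  | nil => simp [monomial]
  | cons j l ih =>
    have e : monomial F (j :: l) = gen F j * monomial F l := by simp [monomial]
    have e2 : gen F j * (-1) ^ l.length = (-1) ^ l.length * gen F j :=
      ((Commute.neg_one_right _).pow_right _).eq
    rw [e, ← mul_assoc, gen_mul_swap, neg_mul, mul_assoc, ih, ← mul_assoc (gen F j), e2,
      List.length_cons, pow_succ]
    noncomm_ring

lemma monomial_mul_monomial (l l' : List ℕ) :
    monomial F l * monomial F l' =
      (-1) ^ (l.length * l'.length) * (monomial F l' * monomial F l) := by
  induction l with
  | nil => simp [monomial]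
  | cons j l ih =>
    have e : monomial F (j :: l) = gen F j * monomial F l := by simp [monomial]
    have e2 : gen F j * (-1) ^ (l.length * l'.length) =
        (-1) ^ (l.length * l'.length) * gen F j := ((Commute.neg_one_right _).pow_right _).eq
    rw [e, mul_assoc, ih, ← mul_assoc (gen F j), e2, mul_assoc, ← mul_assoc (gen F j),
      gen_mul_monomial, List.length_cons, Nat.succ_mul, pow_add]
    simp only [mul_assoc]

/-- With all generators in degree 0 this component is the span of all monomials; the lemma serves to
show that they span `E`. -/
lemma mem_inducedGrading_zero (x : Grassmann F) : x ∈ inducedGrading F (fun _ => 0) 0 := by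
  induction x using ExteriorAlgebra.induction with
  | algebraMap r => exact SetLike.algebraMap_mem_graded _ r
  | ι x =>
    induction x using Finsupp.induction_linear with
    | zero => rw [map_zero]; exact Submodule.zero_mem _
    | add a b ha hb => rw [map_add]; exact Submodule.add_mem _ ha hb
    | single i c =>
      have h : Finsupp.single i c = c • Finsupp.single i (1 : F) := by simp
      rw [h, map_smul]
      exact Submodule.smul_mem _ _ (gen_mem (fun _ => 0) i)
  | mul a b ha hb => simpa using SetLike.mul_mem_graded ha hb
  | add a b ha hb => exact Submodule.add_mem _ ha hb

/-- A linear property of elements of `E` holds as soon as it holds for the monomials. -/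
lemma monomial_induction {p : Grassmann F → Prop} (hm : ∀ l, p (monomial F l)) (h0 : p 0)
    (ha : ∀ x y, p x → p y → p (x + y)) (hs : ∀ (c : F) x, p x → p (c • x))
    (x : Grassmann F) : p x := by
  have hx := mem_inducedGrading_zero x
  unfold inducedGrading at hx
  induction hx using Submodule.span_induction with
  | mem x h => obtain ⟨l, -, rfl⟩ := h; exact hm l
  | zero => exact h0
  | add x y _ _ hx hy => exact ha _ _ hx hy
  | smul c x _ hx => exact hs _ _ hx

lemma monomial_mem_center {l : List ℕ} (hl : Even l.length) :
    monomial F l ∈ Subring.center (Grassmann F) := by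
  rw [Subring.mem_center_iff]
  intro z
  induction z using monomial_induction with
  | hm l' => rw [monomial_mul_monomial, (hl.mul_left _).neg_one_pow, one_mul]
  | h0 => simp
  | ha x y hx hy => rw [add_mul, mul_add, hx, hy]
  | hs c x hx => rw [smul_mul_assoc, mul_smul_comm, hx]

lemma monomial_mul_monomial_of_odd {l l' : List ℕ} (hl : Odd l.length) (hl' : Odd l'.length) :
    monomial F l * monomial F l' = -(monomial F l' * monomial F l) := by
  rw [monomial_mul_monomial, (hl.mul hl').neg_one_pow, neg_mul, one_mul]

lemma monomial_mul_self {l : List ℕ} (hl : l ≠ []) : monomial F l * monomial F l = 0 := by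
  obtain ⟨i, t, rfl⟩ := List.exists_cons_of_ne_nil hl
  have h := mul_prod_eq_zero_of_mem (gen F) gen_mul_swap (fun _ => ExteriorAlgebra.ι_sq_zero _) i
    (t ++ i :: t) (by simp)
  simpa [monomial, mul_assoc] using h

lemma smul_mem_center (c : F) {x : Grassmann F} (hx : x ∈ Subring.center (Grassmann F)) :
    c • x ∈ Subring.center (Grassmann F) := by
  rw [Subring.mem_center_iff] at hx ⊢
  intro z
  rw [smul_mul_assoc, mul_smul_comm, hx]

/-- By bilinearity monomials suffice: those of even length are central, and two of odd length have
as commutator twice a monomial of even length. -/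
lemma comm_mem_center (x y : Grassmann F) : comm x y ∈ Subring.center (Grassmann F) := by
  induction x using monomial_induction with
  | h0 => simp [comm]
  | ha a b ha hb =>
    have : comm (a + b) y = comm a y + comm b y := by simp only [comm]; noncomm_ring
    rw [this]; exact add_mem ha hb
  | hs c a ha =>
    have : comm (c • a) y = c • comm a y := by simp [comm, smul_sub]
    rw [this]; exact smul_mem_center c ha
  | hm l =>
  induction y using monomial_induction with
  | h0 => simp [comm]
  | ha a b ha hb =>
    have : comm (monomial F l) (a + b) = comm (monomial F l) a + comm (monomial F l) b := by
      simp only [comm]; noncomm_ring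
    rw [this]; exact add_mem ha hb
  | hs c a ha =>
    have : comm (monomial F l) (c • a) = c • comm (monomial F l) a := by simp [comm, smul_sub]
    rw [this]; exact smul_mem_center c ha
  | hm l' =>
  rcases Nat.even_or_odd l.length with hl | hl
  · rw [comm, Subring.mem_center_iff.1 (monomial_mem_center hl), sub_self]
    exact zero_mem _
  rcases Nat.even_or_odd l'.length with hl' | hl'
  · rw [comm, Subring.mem_center_iff.1 (monomial_mem_center hl'), sub_self]
    exact zero_mem _
  · rw [comm, monomial_mul_monomial_of_odd hl' hl, sub_neg_eq_add, ← monomial_append]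
    have := monomial_mem_center (F := F) (l := l ++ l') (by
      rw [List.length_append]; exact hl.add_odd hl')
    exact add_mem this this

variable (F) in
lemma centralComm_grassmann : CentralComm (Grassmann F) := fun a b c =>
  sub_eq_zero.2 (Subring.mem_center_iff.1 (comm_mem_center a b) c).symm

open CliffordAlgebra in
lemma contractLeft_gen_mul (i j : ℕ) (x : Grassmann F) :
    contractLeft (Q := (0 : QuadraticForm F (ℕ →₀ F))) (Finsupp.lapply i) (gen F j * x) =
      (if j = i then x else 0) -
        gen F j * contractLeft (Q := (0 : QuadraticForm F (ℕ →₀ F))) (Finsupp.lapply i) x := by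
  have h := contractLeft_ι_mul (Q := (0 : QuadraticForm F (ℕ →₀ F))) (Finsupp.lapply i)
    (Finsupp.single j 1) x
  refine h.trans ?_
  congr 1
  rw [Finsupp.lapply_apply, Finsupp.single_apply]
  split_ifs <;> simp

open CliffordAlgebra in
lemma contractLeft_monomial (i : ℕ) (l : List ℕ) (hi : i ∉ l) :
    contractLeft (Q := (0 : QuadraticForm F (ℕ →₀ F))) (Finsupp.lapply i) (monomial F l) = 0 := by
  induction l with
  | nil => exact contractLeft_one _ _
  | cons j l ih =>
    have e : monomial F (j :: l) = gen F j * monomial F l := by simp [monomial]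
    rw [List.mem_cons, not_or] at hi
    rw [e, contractLeft_gen_mul, ih hi.2, if_neg (Ne.symm hi.1), mul_zero, sub_zero]

/-- Contraction with the coordinate of the first letter strips that letter, as it does not occur
again. -/
lemma monomial_ne_zero (l : List ℕ) (hl : l.Nodup) : monomial F l ≠ 0 := by
  induction l with
  | nil => simp [monomial]
  | cons j l ih =>
    have e : monomial F (j :: l) = gen F j * monomial F l := by simp [monomial]
    rw [List.nodup_cons] at hl
    intro h
    apply ih hl.2
    have h2 := contractLeft_gen_mul j j (monomial F l)
    rw [← e, h, contractLeft_monomial j l hl.1, map_zero] at h2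
    simpa using h2.symm

end Monomials

/-! ### Supply of disjoint words with prescribed degree and parity. -/

section Words

/-- Words in disjoint sets of generators with prescribed numbers of letters in `S` and `Sᶜ`. -/
lemma exists_disjoint_words (m n : ℤ) (S : Set ℕ) (hS : S.Infinite) (hSc : Sᶜ.Infinite)
    {K : Type*} [Countable K] (A B : K → ℕ) :
    ∃ W : K → List ℕ, (∀ k, (W k).length = A k + B k) ∧
      (∀ k, ((W k).map (twoDegree m n S)).sum = A k * m + B k * n) ∧
      ∀ ks : List K, ks.Nodup → (ks.flatMap W).Nodup := by
  obtain ⟨e, he⟩ := exists_injective_nat (K × ℕ)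
  set s : K → ℕ → ℕ := fun k j => hS.natEmbedding S (e (k, j)) with hs
  set t : K → ℕ → ℕ := fun k j => hSc.natEmbedding Sᶜ (e (k, j)) with ht
  have hsS : ∀ k j, s k j ∈ S := fun k j => (hS.natEmbedding S (e (k, j))).2
  have htS : ∀ k j, t k j ∉ S := fun k j => (hSc.natEmbedding Sᶜ (e (k, j))).2
  have hsi : ∀ k j k' j', s k j = s k' j' → k = k' ∧ j = j' := fun k j k' j' h => by
    simpa using he ((hS.natEmbedding S).injective (Subtype.ext h))
  have hti : ∀ k j k' j', t k j = t k' j' → k = k' ∧ j = j' := fun k j k' j' h => by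
    simpa using he ((hSc.natEmbedding Sᶜ).injective (Subtype.ext h))
  have hst : ∀ k j k' j', s k j ≠ t k' j' := fun k j k' j' h => htS k' j' (h ▸ hsS k j)
  refine ⟨fun k => (List.range (A k)).map (s k) ++ (List.range (B k)).map (t k), ?_, ?_, ?_⟩
  · simp
  · intro k
    rw [List.map_append, List.sum_append, List.map_map, List.map_map,
      List.sum_eq_card_nsmul _ m, List.sum_eq_card_nsmul _ n]
    · simp
    · intro x hx
      obtain ⟨j, -, rfl⟩ := List.mem_map.1 hx
      simp [twoDegree, htS]
    · intro x hx
      obtain ⟨j, -, rfl⟩ := List.mem_map.1 hx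
      simp [twoDegree, hsS]
  · intro ks hks
    rw [List.nodup_flatMap]
    constructor
    · intro k _
      refine List.Nodup.append (List.nodup_range.map fun j j' h => (hsi _ _ _ _ h).2)
        (List.nodup_range.map fun j j' h => (hti _ _ _ _ h).2) ?_
      intro x hx hx'
      obtain ⟨j, -, rfl⟩ := List.mem_map.1 hx
      obtain ⟨j', -, h⟩ := List.mem_map.1 hx'
      exact hst _ _ _ _ h.symm
    · refine hks.imp ?_
      intro k k' hk x hx hx'
      rcases List.mem_append.1 hx with h | h <;> rcases List.mem_append.1 hx' with h' | h' <;>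
        obtain ⟨j, -, rfl⟩ := List.mem_map.1 h <;> obtain ⟨j', -, h'⟩ := List.mem_map.1 h'
      · exact hk (hsi _ _ _ _ h').1.symm
      · exact hst _ _ _ _ h'.symm
      · exact hst _ _ _ _ h'
      · exact hk (hti _ _ _ _ h').1.symm

/-- Every integer is the degree of a nonempty word of even length. -/
lemma exists_even_coeffs (m n : ℤ) (α β α' β' : ℕ)
    (h1 : (1 : ℤ) = α * m + β * n) (h2 : (-1 : ℤ) = α' * m + β' * n)
    (heven : Even (α + β)) (heven' : Even (α' + β')) (r : ℤ) :
    ∃ a b : ℕ, (a : ℤ) * m + b * n = r ∧ Even (a + b) ∧ 0 < a + b := by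
  -- Take the representation of 1 `r⁺ + 1` times and that of -1 `r⁻ + 1` times. The two extra copies
  -- cancel in degree and make the word nonempty even for `r = 0`.
  refine ⟨(r.toNat + 1) * α + ((-r).toNat + 1) * α', (r.toNat + 1) * β + ((-r).toNat + 1) * β',
    ?_, ?_, ?_⟩
  · have hr : (r.toNat : ℤ) - (-r).toNat = r := by omega
    push_cast
    linear_combination hr - (r.toNat + 1 : ℤ) * h1 - ((-r).toNat + 1 : ℤ) * h2
  · have : (r.toNat + 1) * α + ((-r).toNat + 1) * α' +
        ((r.toNat + 1) * β + ((-r).toNat + 1) * β') =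
        (r.toNat + 1) * (α + β) + ((-r).toNat + 1) * (α' + β') := by ring
    rw [this]
    exact (heven.mul_left _).add (heven'.mul_left _)
  · rcases Nat.eq_zero_or_pos (α + β) with h | h
    · obtain ⟨rfl, rfl⟩ : α = 0 ∧ β = 0 := by omega
      simp at h1
    · nlinarith [Nat.zero_le (r.toNat * α), Nat.zero_le (r.toNat * β),
        Nat.zero_le (((-r).toNat + 1) * α'), Nat.zero_le (((-r).toNat + 1) * β')]

end Words

/-! ### Graded identities and reduction modulo the triple commutators. -/

section TIdeals

variable {F : Type*} [Field F]

instance freeComponent.gradedMonoid : SetLike.GradedMonoid (freeComponent F) where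
  one_mem := Submodule.subset_span ⟨[], by simp, by simp⟩
  mul_mem := by
    intro i j x y hx hy
    have h : freeComponent F i * freeComponent F j ≤ freeComponent F (i + j) := by
      unfold freeComponent
      rw [Submodule.span_mul_span]
      apply Submodule.span_mono
      rintro _ ⟨_, ⟨l, hl, rfl⟩, _, ⟨l', hl', rfl⟩, rfl⟩
      exact ⟨l ++ l', by simp [hl, hl'], by simp⟩
    exact h (Submodule.mul_mem_mul hx hy)

lemma var_mem (i : ℤ) (k : ℕ) : var F i k ∈ freeComponent F i :=
  Submodule.subset_span ⟨[(i, k)], by simp, by simp⟩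

lemma lift_mem_graded {A : Type*} [Ring A] [Algebra F A] (𝒜 : ℤ → Submodule F A)
    [SetLike.GradedMonoid 𝒜] (g : ℤ × ℕ → A) (hg : ∀ p, g p ∈ 𝒜 p.1) (i : ℤ)
    (f : FreeGraded F) (hf : f ∈ freeComponent F i) : FreeAlgebra.lift F g f ∈ 𝒜 i := by
  unfold freeComponent at hf
  induction hf using Submodule.span_induction with
  | mem f h =>
    obtain ⟨l, rfl, rfl⟩ := h
    have e : FreeAlgebra.lift F g (l.map fun p => var F p.1 p.2).prod = (l.map g).prod := by
      rw [map_list_prod, List.map_map]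
      congr 1
      exact List.map_congr_left fun p _ => by simp [var]
    rw [e]
    exact SetLike.list_prod_map_mem_graded l _ _ fun p _ => hg p
  | zero => rw [map_zero]; exact Submodule.zero_mem _
  | add x y _ _ hx hy => rw [map_add]; exact Submodule.add_mem _ hx hy
  | smul c x _ hx => rw [map_smul]; exact Submodule.smul_mem _ _ hx

lemma mem_gradedIdentities {A : Type*} [Ring A] [Algebra F A] (𝒜 : ℤ → Submodule F A)
    [GradedAlgebra 𝒜] (f : FreeGraded F) : f ∈ gradedIdentities 𝒜 ↔
      ∀ g : ℤ × ℕ → A, (∀ p, g p ∈ 𝒜 p.1) → FreeAlgebra.lift F g f = 0 := by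
  unfold gradedIdentities
  rw [TwoSidedIdeal.mem_mk']
  rfl

lemma isTIdeal_gradedIdentities {A : Type*} [Ring A] [Algebra F A] (𝒜 : ℤ → Submodule F A)
    [GradedAlgebra 𝒜] : IsTIdeal (gradedIdentities 𝒜) := by
  intro φ hφ f hf
  rw [mem_gradedIdentities] at hf ⊢
  intro g hg
  have e : (FreeAlgebra.lift F g).comp φ =
      FreeAlgebra.lift F fun p => FreeAlgebra.lift F g (φ (var F p.1 p.2)) := by
    ext p
    simp [var]
  have h := hf (fun p => FreeAlgebra.lift F g (φ (var F p.1 p.2))) fun p =>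
    lift_mem_graded 𝒜 g hg _ _ (hφ _ _ (var_mem _ _))
  rwa [← e] at h

lemma prod_var_induction {p : FreeGraded F → Prop}
    (hm : ∀ l : List (ℤ × ℕ), p (l.map fun q => var F q.1 q.2).prod) (h0 : p 0)
    (ha : ∀ x y, p x → p y → p (x + y)) (hs : ∀ (c : F) x, p x → p (c • x))
    (x : FreeGraded F) : p x := by
  have hx := lift_mem_span_prod (FreeAlgebra.ι F) x
  have e : FreeAlgebra.lift F (FreeAlgebra.ι F) x = x := by
    have h : FreeAlgebra.lift F (FreeAlgebra.ι F) = AlgHom.id F (FreeGraded F) := by ext; simp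
    rw [h, AlgHom.id_apply]
  rw [e] at hx
  clear e
  induction hx using Submodule.span_induction with
  | mem x h => obtain ⟨l, rfl⟩ := h; exact hm l
  | zero => exact h0
  | add x y _ _ hx hy => exact ha _ _ hx hy
  | smul c x _ hx => exact hs _ _ hx

lemma smul_mem_twoSidedIdeal {R : Type*} [Ring R] [Algebra F R] (I : TwoSidedIdeal R) (c : F)
    {x : R} (hx : x ∈ I) : c • x ∈ I := by
  rw [Algebra.smul_def]
  exact I.mul_mem_left _ _ hx

/-- A `T_ℤ`-ideal with the triple commutators of the variables contains all triple commutators. -/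
lemma IsTIdeal.comm_mem {I : TwoSidedIdeal (FreeGraded F)} (hI : IsTIdeal I)
    (hP : ∀ f ∈ tripleCommutators F, f ∈ I) (a b c : FreeGraded F) :
    comm (comm a b) c ∈ I := by
  have key : ∀ i j k, ∀ a ∈ freeComponent F i, ∀ b ∈ freeComponent F j,
      ∀ c ∈ freeComponent F k, comm (comm a b) c ∈ I := by
    intro i j k a ha b hb c hc
    -- The indices 1, 2, 3 keep the three variables distinct even when degrees coincide.
    -- Trilinearity then extends the homogeneous case to all entries.
    set g : ℤ × ℕ → FreeGraded F := fun p => if p = (i, 1) then a else if p = (j, 2) then b else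
      if p = (k, 3) then c else var F p.1 p.2 with hg
    have h := hI (FreeAlgebra.lift F g) (fun i f hf => lift_mem_graded (freeComponent F) g (by
      intro p
      simp only [hg]
      split_ifs with h1 h2 h3
      · rw [h1]; exact ha
      · rw [h2]; exact hb
      · rw [h3]; exact hc
      · exact var_mem _ _) i f hf) _ (hP _ ⟨i, j, k, rfl⟩)
    simpa [map_comm, var, hg] using h
  have hl : ∀ l : List (ℤ × ℕ), (l.map fun q => var F q.1 q.2).prod ∈
      freeComponent F (l.map Prod.fst).sum := fun l => Submodule.subset_span ⟨l, rfl, rfl⟩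
  induction a using prod_var_induction with
  | h0 => simp [comm, I.zero_mem]
  | ha x y hx hy =>
    have : comm (comm (x + y) b) c = comm (comm x b) c + comm (comm y b) c := by
      simp only [comm]; noncomm_ring
    rw [this]; exact I.add_mem hx hy
  | hs r x hx =>
    have : comm (comm (r • x) b) c = r • comm (comm x b) c := by
      simp [comm, smul_sub, mul_sub, sub_mul]
    rw [this]; exact smul_mem_twoSidedIdeal I r hx
  | hm l =>
  induction b using prod_var_induction with
  | h0 => simp [comm, I.zero_mem]
  | ha x y hx hy =>
    rw [show ∀ z, comm (comm z (x + y)) c = comm (comm z x) c + comm (comm z y) c by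
      intro z; simp only [comm]; noncomm_ring]
    exact I.add_mem hx hy
  | hs r x hx =>
    rw [show ∀ z, comm (comm z (r • x)) c = r • comm (comm z x) c by
      intro z; simp [comm, smul_sub, mul_sub, sub_mul]]
    exact smul_mem_twoSidedIdeal I r hx
  | hm l' =>
  induction c using prod_var_induction with
  | h0 => simp [comm, I.zero_mem]
  | ha x y hx hy =>
    rw [show ∀ z, comm z (x + y) = comm z x + comm z y by
      intro z; simp only [comm]; noncomm_ring]
    exact I.add_mem hx hy
  | hs r x hx =>
    rw [show ∀ z, comm z (r • x) = r • comm z x by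
      intro z; simp [comm, smul_sub]]
    exact smul_mem_twoSidedIdeal I r hx
  | hm l'' => exact key _ _ _ _ (hl l) _ (hl l') _ (hl l'')

/-- Modulo an ideal that contains all triple commutators, every polynomial is a linear
combination of normal forms. -/
lemma exists_normalForm_sub_mem [CharZero F] {ι : Type*} (I : TwoSidedIdeal (FreeAlgebra F ι))
    (hI : ∀ a b c, comm (comm a b) c ∈ I) (f : FreeAlgebra F ι) :
    ∃ c : (Multiset ι × Finset ι) →₀ F,
      f - c.sum (fun q r => r • normalForm (FreeAlgebra.ι F) q) ∈ I := by
  -- The quotient by `I` has central commutators, so normal forms span it.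
  let π : FreeAlgebra F ι →ₐ[F] I.ringCon.Quotient :=
    { I.ringCon.mk' with commutes' := fun _ => rfl }
  have hπ : ∀ f, π f = 0 ↔ f ∈ I := fun f => by
    rw [TwoSidedIdeal.mem_iff]
    exact RingCon.eq I.ringCon
  have hsurj : Function.Surjective π := RingCon.mk'_surjective I.ringCon
  have hQ : CentralComm I.ringCon.Quotient := by
    intro a b c
    obtain ⟨a, rfl⟩ := hsurj a
    obtain ⟨b, rfl⟩ := hsurj b
    obtain ⟨c, rfl⟩ := hsurj c
    rw [← map_comm, ← map_comm, hπ]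
    exact hI a b c
  have h := lift_mem_normalSpan hQ (fun i => π (FreeAlgebra.ι F i)) f
  have e : FreeAlgebra.lift F (fun i => π (FreeAlgebra.ι F i)) = π := by ext; simp
  rw [e] at h
  obtain ⟨c, hc⟩ := Finsupp.mem_span_range_iff_exists_finsupp.1 h
  refine ⟨c, ?_⟩
  rw [← hπ, map_sub, ← hc, map_finsuppSum, sub_eq_zero]
  refine Finsupp.sum_congr fun q _ => ?_
  rw [map_smul, map_normalForm]

end TIdeals

/-! ### Triangularity of the probing substitutions. -/

section Independence

variable {F : Type*} [Field F] {ι : Type*} [DecidableEq ι]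

/-- If for each normal form a probing substitution is available at which it does not vanish, a
combination of normal forms that vanishes at these substitutions is zero. -/
lemma coeff_eq_zero_of_probe {A : Type*} [Ring A] [Algebra F A]
    (w : ι → ℕ → Subring.center A) (v : ι → A) (hw : ∀ p j, w p j * w p j = 0)
    (hv : ∀ p q, v p * v q = -(v q * v p)) (hv2 : ∀ p, v p * v p = 0)
    (hne : ∀ q : Multiset ι × Finset ι, Even q.2.card → normalForm (probe w v q) q ≠ 0)
    (c : (Multiset ι × Finset ι) →₀ F)
    (hc : ∀ q, c.sum (fun r a => a • normalForm (probe w v q) r) = 0) :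
    ∀ q : Multiset ι × Finset ι, Even q.2.card → c q = 0 := by
  -- Outer induction on the number of variables in commutators, inner on the size of the multiset:
  -- at the probe of `q`, every other term vanishes or has a coefficient already known to be zero.
  have main : ∀ s t : ℕ, ∀ q : Multiset ι × Finset ι, q.2.card = s → q.1.card = t →
      Even q.2.card → c q = 0 := by
    intro s
    induction s using Nat.strong_induction_on with
    | _ s ihs =>
    intro t
    induction t using Nat.strong_induction_on with
    | _ t iht =>
    intro q hs ht hq
    have h := hc q
    rw [Finsupp.sum, Finset.sum_eq_single q] at h
    · exact (smul_eq_zero.1 h).resolve_right (hne q hq)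
    · rintro ⟨b, T⟩ - hr
      rcases Nat.even_or_odd T.card with hT | hT
      swap
      · rw [normalForm, commProd_of_odd _ T.toList (by simpa using hT), mul_zero, smul_zero]
      by_cases hsub : T ⊆ q.2
      swap
      · rw [normalForm_probe_of_not_subset w v q _ hsub, smul_zero]
      rcases (Finset.card_le_card hsub).lt_or_eq with hlt | heq
      · rw [ihs _ (hs ▸ hlt) _ (b, T) rfl rfl hT, zero_smul]
      obtain rfl := Finset.eq_of_subset_of_card_le hsub heq.ge
      by_cases hb : b ≤ q.1
      swap
      · rw [normalForm_probe_of_not_le w v hw hv hv2 q hq b hb, smul_zero]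
      rcases (Multiset.card_le_card hb).lt_or_eq with hlt | heq
      · rw [iht _ (ht ▸ hlt) (b, q.2) hs rfl hq, zero_smul]
      · exact absurd (Prod.ext (Multiset.eq_of_le_of_card_le hb heq.ge) rfl : (b, q.2) = q) hr
    · intro hq
      rw [Finsupp.notMem_support_iff.1 hq, zero_smul]
  exact fun q hq => main _ _ q rfl rfl hq

end Independence

/-! ### Linear independence of normal forms modulo the identities of `E`. -/

section Grassmann

variable {F : Type*} [Field F] [CharZero F]

lemma sum_normalForm_eq_zero (m n : ℤ) (S : Set ℕ) (hS : S.Infinite) (hSc : Sᶜ.Infinite)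
    (α β α' β' : ℕ)
    (h1 : (1 : ℤ) = α * m + β * n) (h2 : (-1 : ℤ) = α' * m + β' * n)
    (heven : Even (α + β)) (heven' : Even (α' + β'))
    (c : (Multiset (ℤ × ℕ) × Finset (ℤ × ℕ)) →₀ F)
    (hc : c.sum (fun q r => r • normalForm (FreeAlgebra.ι F) q) ∈
      gradedIdentities (twoInduced F m n S)) :
    c.sum (fun q r => r • normalForm (FreeAlgebra.ι F) q) = 0 := by
  choose a b hab hpar hpos using exists_even_coeffs m n α β α' β' h1 h2 heven heven'
  -- The words `inl (p, j)` are the even ones of degree `p.1`. The word `inr p` takes even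
  -- coefficients for degree `p.1 - m` and one more letter from `S`, so it is odd of degree `p.1`.
  obtain ⟨W, hlen, hdeg, hnodup⟩ := exists_disjoint_words m n S hS hSc
    (K := ((ℤ × ℕ) × ℕ) ⊕ (ℤ × ℕ))
    (Sum.elim (fun k => a k.1.1) fun p => a (p.1 - m) + 1)
    (Sum.elim (fun k => b k.1.1) fun p => b (p.1 - m))
  have hWeven : ∀ k, Even (W (Sum.inl k)).length := fun k => by rw [hlen]; exact hpar _
  have hWodd : ∀ p, Odd (W (Sum.inr p)).length := fun p => by
    rw [hlen]
    simpa [add_right_comm] using (hpar (p.1 - m)).add_one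
  have hWne : ∀ k, W k ≠ [] := by
    rintro (k | p) h
    · have := hlen (Sum.inl k)
      have := hpos k.1.1
      simp_all
    · have := hWodd p
      simp [h] at this
  have hmem : ∀ k r, Sum.elim (fun k : (ℤ × ℕ) × ℕ => k.1.1) (fun p : ℤ × ℕ => p.1) k = r →
      monomial F (W k) ∈ twoInduced F m n S r := by
    intro k r hr
    refine Submodule.subset_span ⟨W k, ?_, rfl⟩
    rw [hdeg, ← hr]
    rcases k with k | p
    · exact hab _
    · have := hab (p.1 - m)
      simp only [Sum.elim_inr]
      push_cast
      linear_combination this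
  let w : ℤ × ℕ → ℕ → Subring.center (Grassmann F) := fun p j =>
    ⟨monomial F (W (Sum.inl (p, j))), monomial_mem_center (hWeven _)⟩
  let v : ℤ × ℕ → Grassmann F := fun p => monomial F (W (Sum.inr p))
  have hw : ∀ p j, w p j * w p j = 0 := fun p j => Subtype.ext (monomial_mul_self (hWne _))
  have hv : ∀ p q, v p * v q = -(v q * v p) := fun p q =>
    monomial_mul_monomial_of_odd (hWodd p) (hWodd q)
  have hv2 : ∀ p, v p * v p = 0 := fun p => monomial_mul_self (hWne _)
  have hne : ∀ q : Multiset (ℤ × ℕ) × Finset (ℤ × ℕ), Even q.2.card →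
      normalForm (probe w v q) q ≠ 0 := by
    intro q hq
    rw [normalForm_probe_self w v hw hv hv2 q hq]
    set ks := (q.1.toFinset.sigma fun p => Finset.range (q.1.count p)).toList with hks
    have e : (ks.map fun x => (w x.1 x.2 : Grassmann F)).prod * (q.2.toList.map v).prod =
        monomial F ((ks.map (fun x : (_ : ℤ × ℕ) × ℕ => Sum.inl (x.fst, x.snd)) ++
          q.2.toList.map Sum.inr).flatMap W) := by
      rw [monomial_flatMap, List.map_append, List.prod_append, List.map_map, List.map_map]
      rfl
    have hnd : (ks.map (fun x : (_ : ℤ × ℕ) × ℕ =>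
        (Sum.inl (x.fst, x.snd) : ((ℤ × ℕ) × ℕ) ⊕ (ℤ × ℕ))) ++
        q.2.toList.map Sum.inr).Nodup := by
      refine List.Nodup.append ((Finset.nodup_toList _).map ?_)
        ((Finset.nodup_toList _).map Sum.inr_injective) ?_
      · rintro ⟨p, j⟩ ⟨p', j'⟩ h
        simp only [Sum.inl.injEq, Prod.mk.injEq] at h
        obtain ⟨rfl, rfl⟩ := h
        rfl
      · intro x hx hx'
        obtain ⟨y, -, rfl⟩ := List.mem_map.1 hx
        obtain ⟨z, -, h⟩ := List.mem_map.1 hx'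
        cases h
    -- A power of 2 times factorials is nonzero in `F` by characteristic zero, and the words
    -- involved are disjoint.
    rw [e, ← nsmul_eq_mul, ← Nat.cast_smul_eq_nsmul F]
    refine smul_ne_zero (Nat.cast_ne_zero.2 ?_) (monomial_ne_zero _ (hnodup _ hnd))
    exact mul_ne_zero (by positivity)
      (Finset.prod_ne_zero_iff.2 fun p _ => Nat.factorial_ne_zero _)
  rw [mem_gradedIdentities] at hc
  have hzero := coeff_eq_zero_of_probe w v hw hv hv2 hne c fun q => by
    have h := hc (probe w v q) fun p => by
      refine Submodule.add_mem _ ?_ ?_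
      · rw [AddSubmonoidClass.coe_finsetSum]
        exact Submodule.sum_mem _ fun j _ => hmem (Sum.inl (p, j)) _ rfl
      · split_ifs
        · exact hmem (Sum.inr p) _ rfl
        · exact Submodule.zero_mem _
    rw [map_finsuppSum] at h
    rw [← h]
    refine Finsupp.sum_congr fun r _ => ?_
    rw [map_smul, map_normalForm]
    simp
  -- Coefficients at odd sets are not determined, but there the normal form itself is zero.
  refine Finset.sum_eq_zero fun q _ => ?_
  rcases Nat.even_or_odd q.2.card with hq | hq
  · simp only [hzero q hq, zero_smul]
  · simp only [normalForm, commProd_of_odd (FreeAlgebra.ι F) q.2.toList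
      (by simpa using hq), mul_zero, smul_zero]

end Grassmann

end GradedPI

end

theorem proposition3p4 {F : Type*} [Field F] [CharZero F] (m n : ℤ) (hmn : m < n)
    (S : Set ℕ) (hS : S.Infinite) (hSc : Sᶜ.Infinite)
    (hsupp : GradedPI.gradingSupport (GradedPI.twoInduced F m n S) = Set.univ)
    (α β α' β' : ℕ)
    (h1 : (1 : ℤ) = α * m + β * n) (h2 : (-1 : ℤ) = α' * m + β' * n)
    (heven : Even (α + β)) (heven' : Even (α' + β')) :
    GradedPI.GeneratesVariety (GradedPI.twoInduced F m n S) (GradedPI.tripleCommutators F) := by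
  have hle : GradedPI.tIdealSpan (GradedPI.tripleCommutators F) ≤
      GradedPI.gradedIdentities (GradedPI.twoInduced F m n S) := by
    refine sInf_le ⟨GradedPI.isTIdeal_gradedIdentities _, ?_⟩
    rintro _ ⟨i, j, k, rfl⟩
    rw [GradedPI.mem_gradedIdentities]
    intro g _
    rw [GradedPI.map_comm, GradedPI.map_comm]
    exact GradedPI.centralComm_grassmann F _ _ _
  refine le_antisymm hle fun f hf => ?_
  obtain ⟨c, hc⟩ := GradedPI.exists_normalForm_sub_mem
    (GradedPI.tIdealSpan (GradedPI.tripleCommutators F)) (fun a b c => by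
      unfold GradedPI.tIdealSpan
      rw [TwoSidedIdeal.mem_sInf]
      exact fun I hI => hI.1.comm_mem hI.2 a b c) f
  -- The combination of normal forms differs from `f` by an identity, hence is itself an identity
  -- and therefore zero.
  have hs := TwoSidedIdeal.sub_mem _ hf (hle hc)
  rw [sub_sub_cancel] at hs
  have h0 := GradedPI.sum_normalForm_eq_zero m n S hS hSc α β α' β' h1 h2 heven heven' c hs
  rwa [h0, sub_zero] at hc
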